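/- Let $q$ be a random vector and let $u(q)$ be a real-valued measurable function of $q$, with cumulative distribution function $F_u(\gamma)=P\{u(q)\le\gamma\}$; no continuity of $F_u$ is assumed. Let $q^1,\dots,q^N$ be independent samples of $q$, each with the same distribution as $q$, and let $\hat u_1\le\hat u_2\le\cdots\le\hat u_N$ be the order statistics of $u(q^1),\dots,u(q^N)$, i.e. $\hat u_i$ is the $i$-th smallest of these $N$ values. Let $1\le k\le N$, let $1\le i_1<i_2<\cdots<i_k\le N$ be integers, and let $0\le t_1\le t_2\le\cdots\le t_k\le 1$ be real numbers. Put $x_0:=0$, $x_{k+1}:=1$, $i_0:=0$, $i_{k+1}:=N+1$ and $$f_{i_1,\dots,i_k}(x_1,\dots,x_k):=N!\prod_{s=0}^{k}\frac{(x_{s+1}-x_s)^{i_{s+1}-i_s-1}}{(i_{s+1}-i_s-1)!},$$ and for real numbers $a_1,\dots,a_k$ put $$\mathbf D_{a_1,\dots,a_k}:=\{(x_1,\dots,x_k):\ 0\le x_1\le x_2\le\cdots\le x_k,\ x_s\le a_s,\ s=1,\dots,k\}.$$ Let $\tau_s:=\sup\{F_u(x):\ x\in\mathbb R,\ F_u(x)<t_s\}$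 for $s=1,\dots,k$, with the convention $\sup\emptyset:=0$, and let $$\tilde F(t_1,\dots,t_k):=P\{F_u(\hat u_{i_1})<t_1,\ F_u(\hat u_{i_2})<t_2,\ \dots,\ F_u(\hat u_{i_k})<t_k\}.$$ Then $$\tilde F(t_1,\dots,t_k)=\int_{\mathbf D_{\tau_1,\dots,\tau_k}} f_{i_1,\dots,i_k}(x_1,\dots,x_k)\,dx_1\cdots dx_k.$$ Furthermore, $$\tilde F(t_1,\dots,t_k)\le\int_{\mathbf D_{t_1,\dots,t_k}} f_{i_1,\dots,i_k}(x_1,\dots,x_k)\,dx_1\cdots dx_k,$$ and equality holds if $F_u$ is continuous. -/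

import Mathlib

open MeasureTheory ProbabilityTheory

namespace OrderStat

/-- Increasing rearrangement of a finite sample: `orderStat v r` is the `(r + 1)`-th smallest of the
observations `v 0, …, v (N - 1)`, counted with multiplicity (ranks in `Fin N` start at `0`). -/
noncomputable def orderStat {N : ℕ} (v : Fin N → ℝ) (r : Fin N) : ℝ :=
  v (Tuple.sort v r)

/-- The points `0, x₁, …, x_k, 1`, i.e. `x` extended by `x₀ = 0` and `x_{k+1} = 1`. -/
noncomputable def extPoint {k : ℕ} (x : Fin k → ℝ) : Fin (k + 2) → ℝ :=
  Fin.cons (α := fun _ => ℝ) 0 (Fin.snoc (α := fun _ => ℝ) x 1)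

/-- The ranks `0, i₁, …, i_k, N + 1`, i.e. the ranks (counted from `1`) extended by `i₀ = 0` and
`i_{k+1} = N + 1`. Since `i s : Fin N` counts from `0`, the rank counted from `1` is `i s + 1`. -/
def extRank {k N : ℕ} (i : Fin k → Fin N) : Fin (k + 2) → ℕ :=
  Fin.cons (α := fun _ => ℕ) 0 (Fin.snoc (α := fun _ => ℕ) (fun s => (i s : ℕ) + 1) (N + 1))

/-- The function
`N! ∏_{s=0}^{k} (x_{s+1} - x_s)^(i_{s+1} - i_s - 1) / (i_{s+1} - i_s - 1)!`. -/
noncomputable def density {k N : ℕ} (i : Fin k → Fin N) (x : Fin k → ℝ) : ℝ :=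
  (N.factorial : ℝ) * ∏ s : Fin (k + 1),
    (extPoint x s.succ - extPoint x s.castSucc) ^
        (extRank i s.succ - extRank i s.castSucc - 1) /
      ((extRank i s.succ - extRank i s.castSucc - 1).factorial : ℝ)

/-- The region `{(x₁, …, x_k) : 0 ≤ x₁ ≤ ⋯ ≤ x_k, x_s ≤ t_s for all s}`. -/
def region {k : ℕ} (t : Fin k → ℝ) : Set (Fin k → ℝ) :=
  {x | (∀ s, 0 ≤ x s) ∧ Monotone x ∧ ∀ s, x s ≤ t s}

/-- `sup {F x : F x < a}`; it is `0` if no value of `F` is below `a`. -/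
noncomputable def supBelow (F : ℝ → ℝ) (a : ℝ) : ℝ :=
  sSup (F '' {x | F x < a})

end OrderStat

/-! The law of `u(q)` is the image of Lebesgue measure on `(0, 1)` under the quantile function
(`map_quantile`), so the sample may be taken to be the quantiles of independent uniform variables.
Quantiles preserve order, and `F (quantile p) < t` means `p ≤ τ` for every `p` in `(0, 1)` except
possibly `p = τ` (`cdf_quantile_lt_iff`); jumps of `F` enter only through `τ`. The probability is
therefore the volume of a permutation-invariant subset of the cube, that is, `N!` times the volume
of its increasing part (`lintegral_eq_factorial_mul_monotone`).

Integrating out the unselected coordinates turns each gap containing `m` of them into `(x_{s+1} -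
x_s)^m / m!` (`lintegral_monotone_comp`), which produces the density. The inequality follows from `τ
≤ t` and nonnegativity of the density; if `F` is continuous, the intermediate value theorem gives `τ
= t`. -/

namespace OrderStat

/-! ### Integrating out the unselected coordinates of an increasing chain -/

/-- The points `a, x₁, …, x_k, 1`. -/
noncomputable def withEnds {k : ℕ} (a : ℝ) (x : Fin k → ℝ) : Fin (k + 2) → ℝ :=
  Fin.cons (α := fun _ => ℝ) a (Fin.snoc (α := fun _ => ℝ) x 1)

/-- The volume of the increasing configurations on `[a, 1]` whose coordinates of index `i s` are
prescribed to be `x s`. -/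
noncomputable def gapWeight {k N : ℕ} (a : ℝ) (i : Fin k → Fin N) (x : Fin k → ℝ) : ℝ :=
  ∏ s : Fin (k + 1), (withEnds a x s.succ - withEnds a x s.castSucc) ^
        (extRank i s.succ - extRank i s.castSucc - 1) /
      ((extRank i s.succ - extRank i s.castSucc - 1).factorial : ℝ)

open Classical in
/-- `gapWeight` cut off outside the increasing configurations. -/
noncomputable def chainWeight {k N : ℕ} (a : ℝ) (i : Fin k → Fin N) (x : Fin k → ℝ) : ENNReal :=
  if Monotone (withEnds a x) then ENNReal.ofReal (gapWeight a i x) else 0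

lemma monotone_cons_iff {n : ℕ} (a : ℝ) (v : Fin (n + 1) → ℝ) :
    Monotone (Fin.cons (α := fun _ => ℝ) a v : Fin (n + 2) → ℝ) ↔ a ≤ v 0 ∧ Monotone v := by
  rw [Fin.monotone_iff_le_succ, Fin.monotone_iff_le_succ, Fin.forall_fin_succ]
  simp

lemma withEnds_cons {k : ℕ} (a b : ℝ) (x : Fin k → ℝ) :
    withEnds a (Fin.cons (α := fun _ => ℝ) b x : Fin (k + 1) → ℝ)
      = Fin.cons (α := fun _ => ℝ) a (withEnds b x) := by
  unfold withEnds
  rw [← Fin.cons_snoc_eq_snoc_cons b x 1]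

lemma monotone_withEnds_cons {k : ℕ} (a b : ℝ) (x : Fin k → ℝ) :
    Monotone (withEnds a (Fin.cons (α := fun _ => ℝ) b x : Fin (k + 1) → ℝ))
      ↔ a ≤ b ∧ Monotone (withEnds b x) := by
  rw [withEnds_cons, monotone_cons_iff]
  simp [withEnds]

/-- The artificial rank `0` becomes the selected rank `1`, so all old gaps keep their length and the
new first gap is empty. -/
lemma extRank_cons_zero_succ {k N : ℕ} (i : Fin k → Fin N) (s : Fin (k + 2)) :
    extRank (Fin.cons (α := fun _ => Fin (N + 1)) 0 (Fin.succ ∘ i) : Fin (k + 1) → Fin (N + 1))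
      s.succ = extRank i s + 1 := by
  unfold extRank
  rw [Fin.cons_succ]
  refine Fin.lastCases ?_ (fun s => ?_) s
  · rw [Fin.snoc_last, ← Fin.succ_last, Fin.cons_succ, Fin.snoc_last]
  · rw [Fin.snoc_castSucc]
    refine Fin.cases ?_ (fun s => ?_) s
    · simp
    · rw [← Fin.succ_castSucc, Fin.cons_succ, Fin.cons_succ, Fin.snoc_castSucc]; simp

/-- Only the artificial rank `0` stays put, so the first gap alone grows by one. -/
lemma extRank_succ_comp {k N : ℕ} (i : Fin k → Fin N) (s : Fin (k + 1)) :
    extRank (Fin.succ ∘ i) s.succ = extRank i s.succ + 1 := by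
  unfold extRank
  rw [Fin.cons_succ, Fin.cons_succ]
  refine Fin.lastCases ?_ (fun s => ?_) s
  · rw [Fin.snoc_last, Fin.snoc_last]
  · rw [Fin.snoc_castSucc, Fin.snoc_castSucc]; simp

lemma extRank_zero {k N : ℕ} (i : Fin k → Fin N) : extRank i 0 = 0 := rfl

lemma extRank_one_pos {k N : ℕ} (i : Fin k → Fin N) : 0 < extRank i (Fin.succ 0) := by
  unfold extRank
  rw [Fin.cons_succ]
  refine Fin.lastCases (motive := fun s => 0 < (Fin.snoc (α := fun _ => ℕ)
    (fun s => (i s : ℕ) + 1) (N + 1) : Fin (k + 1) → ℕ) s) ?_ (fun s => ?_) 0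
  · rw [Fin.snoc_last]; omega
  · rw [Fin.snoc_castSucc]; omega

lemma gapWeight_nonneg {k N : ℕ} {a : ℝ} (i : Fin k → Fin N) {x : Fin k → ℝ}
    (h : Monotone (withEnds a x)) : 0 ≤ gapWeight a i x :=
  Finset.prod_nonneg fun s _ => div_nonneg
    (pow_nonneg (sub_nonneg.2 (h (Fin.castSucc_le_succ s))) _) (Nat.cast_nonneg _)

lemma continuous_withEnds {k : ℕ} (s : Fin (k + 2)) :
    Continuous fun p : ℝ × (Fin k → ℝ) => withEnds p.1 p.2 s := by
  unfold withEnds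
  refine Fin.cases ?_ (fun s => ?_) s
  · simpa using continuous_fst
  · simp only [Fin.cons_succ]
    refine Fin.lastCases ?_ (fun s => ?_) s
    · simpa using continuous_const
    · simp only [Fin.snoc_castSucc]; fun_prop

lemma continuous_gapWeight {k N : ℕ} (i : Fin k → Fin N) :
    Continuous fun p : ℝ × (Fin k → ℝ) => gapWeight p.1 i p.2 := by
  unfold gapWeight
  refine continuous_finsetProd _ fun s _ => ?_
  exact (((continuous_withEnds _).sub (continuous_withEnds _)).pow _).div_const _

lemma measurableSet_monotone_withEnds {k : ℕ} :
    MeasurableSet {p : ℝ × (Fin k → ℝ) | Monotone (withEnds p.1 p.2)} := by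
  simp only [Fin.monotone_iff_le_succ, Set.ofPred_forall]
  exact MeasurableSet.iInter fun s =>
    (isClosed_le (continuous_withEnds _) (continuous_withEnds _)).measurableSet

lemma measurable_chainWeight {k N : ℕ} (i : Fin k → Fin N) :
    Measurable fun p : ℝ × (Fin k → ℝ) => chainWeight p.1 i p.2 :=
  Measurable.ite measurableSet_monotone_withEnds
    (continuous_gapWeight i).measurable.ennreal_ofReal measurable_const

lemma chainWeight_cons {k N : ℕ} (a b : ℝ) (i : Fin k → Fin N) (x : Fin k → ℝ) :
    chainWeight a
        (Fin.cons (α := fun _ => Fin (N + 1)) 0 (Fin.succ ∘ i) : Fin (k + 1) → Fin (N + 1))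
        (Fin.cons (α := fun _ => ℝ) b x)
      = if a ≤ b then chainWeight b i x else 0 := by
  classical
  have h : gapWeight a
        (Fin.cons (α := fun _ => Fin (N + 1)) 0 (Fin.succ ∘ i) : Fin (k + 1) → Fin (N + 1))
        (Fin.cons (α := fun _ => ℝ) b x) = gapWeight b i x := by
    unfold gapWeight
    rw [Fin.prod_univ_succ]
    simp only [withEnds_cons, ← Fin.succ_castSucc, Fin.cons_succ, extRank_cons_zero_succ,
      Fin.castSucc_zero, extRank_zero, Nat.add_sub_add_right]
    simp
  unfold chainWeight
  rw [h]
  simp only [monotone_withEnds_cons]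
  by_cases hab : a ≤ b <;> simp [hab]

lemma lintegral_Icc_pow_sub_div_factorial {a c : ℝ} (hac : a ≤ c) (m : ℕ) {R : ℝ} (hR : 0 ≤ R) :
    ∫⁻ b in Set.Icc a c, ENNReal.ofReal ((c - b) ^ m / (m.factorial : ℝ) * R)
      = ENNReal.ofReal ((c - a) ^ (m + 1) / ((m + 1).factorial : ℝ) * R) := by
  have hc : Continuous fun b : ℝ => (c - b) ^ m / (m.factorial : ℝ) * R := by fun_prop
  rw [← ofReal_integral_eq_lintegral_ofReal]
  · rw [integral_Icc_eq_integral_Ioc, ← intervalIntegral.integral_of_le hac,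
      intervalIntegral.integral_mul_const, intervalIntegral.integral_div,
      intervalIntegral.integral_comp_sub_left (fun b => b ^ m) c]
    rw [sub_self, integral_pow, Nat.factorial_succ]
    congr 2
    push_cast
    field_simp
    simp
  · exact hc.integrableOn_Icc
  · refine (ae_restrict_iff' measurableSet_Icc).2 (ae_of_all _ fun b hb => ?_)
    have := sub_nonneg.2 hb.2
    simp only [Pi.zero_apply]
    positivity

lemma gapWeight_eq_head_mul {k N : ℕ} (a : ℝ) (i : Fin k → Fin N) (x : Fin k → ℝ) :
    gapWeight a i x
      = (withEnds a x (Fin.succ 0) - a) ^ (extRank i (Fin.succ 0) - 1) /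
          ((extRank i (Fin.succ 0) - 1).factorial : ℝ) *
        ∏ s : Fin k, (withEnds a x s.succ.succ - withEnds a x s.castSucc.succ) ^
          (extRank i s.succ.succ - extRank i s.castSucc.succ - 1) /
          ((extRank i s.succ.succ - extRank i s.castSucc.succ - 1).factorial : ℝ) := by
  unfold gapWeight
  rw [Fin.prod_univ_succ]
  simp only [← Fin.succ_castSucc, Fin.castSucc_zero, extRank_zero, Nat.sub_zero]
  simp [withEnds]

/-- Only the first gap depends on `b`; integrating it from `a` to the next point raises its exponent
by one. -/
lemma lintegral_chainWeight {k N : ℕ} (a : ℝ) (i : Fin k → Fin N) (x : Fin k → ℝ) :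
    ∫⁻ b, (if a ≤ b then chainWeight b i x else 0) = chainWeight a (Fin.succ ∘ i) x := by
  classical
  set v : Fin (k + 1) → ℝ := Fin.snoc (α := fun _ => ℝ) x 1 with hv
  have hmono (b : ℝ) : Monotone (withEnds b x) ↔ b ≤ v 0 ∧ Monotone v := monotone_cons_iff b v
  have hsucc (b : ℝ) (s : Fin (k + 1)) : withEnds b x s.succ = v s := by
    simp [withEnds, hv]
  by_cases hvm : Monotone v
  swap
  · simp [chainWeight, hmono, hvm]
  set R : ℝ := ∏ s : Fin k, (v s.succ - v s.castSucc) ^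
          (extRank i s.succ.succ - extRank i s.castSucc.succ - 1) /
          ((extRank i s.succ.succ - extRank i s.castSucc.succ - 1).factorial : ℝ) with hRdef
  have hR : 0 ≤ R := Finset.prod_nonneg fun s _ => div_nonneg
    (pow_nonneg (sub_nonneg.2 (hvm (Fin.castSucc_le_succ s))) _) (Nat.cast_nonneg _)
  -- Positivity of the first rank keeps the truncated subtraction in the exponent exact.
  obtain ⟨m, hm⟩ : ∃ m, extRank i (Fin.succ 0) = m + 1 :=
    ⟨_, (Nat.succ_pred_eq_of_pos (extRank_one_pos i)).symm⟩
  have h1 (b : ℝ) : gapWeight b i x = (v 0 - b) ^ m / (m.factorial : ℝ) * R := by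
    rw [gapWeight_eq_head_mul, hm]
    simp only [hsucc, Nat.add_sub_cancel, hRdef]
  have h2 : gapWeight a (Fin.succ ∘ i) x
      = (v 0 - a) ^ (m + 1) / ((m + 1).factorial : ℝ) * R := by
    rw [gapWeight_eq_head_mul, extRank_succ_comp, hm]
    simp only [hsucc, Nat.add_sub_cancel, extRank_succ_comp, Nat.add_sub_add_right, hRdef]
  have h3 : (fun b => if a ≤ b then chainWeight b i x else 0)
      = (Set.Icc a (v 0)).indicator
          fun b => ENNReal.ofReal ((v 0 - b) ^ m / (m.factorial : ℝ) * R) := by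
    funext b
    by_cases hb : a ≤ b <;> by_cases hb' : b ≤ v 0 <;>
      simp [chainWeight, hmono, hvm, hb, hb', h1]
  rw [h3, lintegral_indicator measurableSet_Icc]
  unfold chainWeight
  rw [h2]
  simp only [hmono, hvm, and_true]
  split_ifs with h
  · exact lintegral_Icc_pow_sub_div_factorial h m hR
  · rw [Set.Icc_eq_empty h]; simp

lemma piFinSuccAbove_zero_symm_eq (n : ℕ) :
    ⇑(MeasurableEquiv.piFinSuccAbove (fun _ : Fin (n + 1) => ℝ) 0).symm
      = fun p => Fin.cons (α := fun _ => ℝ) p.1 p.2 := by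
  funext p
  simp [MeasurableEquiv.piFinSuccAbove_symm_apply, Fin.insertNthEquiv]

lemma measurable_fin_cons {n : ℕ} :
    Measurable fun p : ℝ × (Fin n → ℝ) =>
      (Fin.cons (α := fun _ => ℝ) p.1 p.2 : Fin (n + 1) → ℝ) :=
  piFinSuccAbove_zero_symm_eq n ▸
    (MeasurableEquiv.piFinSuccAbove (fun _ : Fin (n + 1) => ℝ) 0).symm.measurable

lemma lintegral_fin_cons {n : ℕ} {f : (Fin (n + 1) → ℝ) → ENNReal} (hf : Measurable f) :
    ∫⁻ x, f x = ∫⁻ b : ℝ, ∫⁻ x : Fin n → ℝ, f (Fin.cons (α := fun _ => ℝ) b x) := by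
  have h := (volume_preserving_piFinSuccAbove (fun _ : Fin (n + 1) => ℝ) 0).symm
  rw [← h.lintegral_comp hf, piFinSuccAbove_zero_symm_eq]
  exact lintegral_prod (fun p : ℝ × (Fin n → ℝ) => f (Fin.cons (α := fun _ => ℝ) p.1 p.2))
    (hf.comp measurable_fin_cons).aemeasurable

-- Induction on `N`, splitting off the smallest coordinate `b`, which becomes the lower endpoint for
-- the others; this is why `a` is arbitrary. If `b` is selected, it is also the first variable of
-- `y` (`chainWeight_cons`); otherwise it is integrated out (`lintegral_chainWeight`).
open Classical in
theorem lintegral_monotone_comp {N : ℕ} : ∀ {k : ℕ} (i : Fin k → Fin N), StrictMono i → ∀ (a : ℝ)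
    {g : (Fin k → ℝ) → ENNReal}, Measurable g →
    ∫⁻ x : Fin N → ℝ, (if Monotone (withEnds a x) then g (x ∘ i) else 0)
      = ∫⁻ y, chainWeight a i y * g y := by
  induction N with
  | zero =>
    intro k i hi a g hg
    cases k with
    | succ k => exact (i 0).elim0
    | zero =>
      rw [volume_pi, Measure.pi_of_empty, lintegral_dirac, lintegral_dirac]
      unfold chainWeight
      have : ∀ x : Fin 0 → ℝ, gapWeight a i x = 1 := by
        intro x
        simp [gapWeight, extRank, Fin.snoc]
      simp only [this, ENNReal.ofReal_one, ite_mul, one_mul, zero_mul]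
      congr 2
  | succ N ih =>
    intro k i hi a g hg
    have hmeas : ∀ {n : ℕ} (b : ℝ), MeasurableSet {x : Fin n → ℝ | Monotone (withEnds b x)} :=
      fun b => measurableSet_monotone_withEnds.preimage (measurable_prodMk_left (x := b))
    have hcomp : ∀ {m n : ℕ} (j : Fin m → Fin n), Measurable fun x : Fin n → ℝ => x ∘ j :=
      fun j => measurable_pi_lambda _ fun s => measurable_pi_apply (j s)
    rw [lintegral_fin_cons (f := fun x : Fin (N + 1) → ℝ =>
      if Monotone (withEnds a x) then g (x ∘ i) else 0)
      (Measurable.ite (hmeas a) (hg.comp (hcomp i)) measurable_const)]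
    simp only [monotone_withEnds_cons]
    by_cases h0 : ∃ s, i s = 0
    · cases k with
      | zero => exact h0.choose.elim0
      | succ k =>
        have hi0 : i 0 = 0 := by
          obtain ⟨s, hs⟩ := h0
          exact le_antisymm (hs ▸ hi.monotone (Fin.zero_le s)) (Fin.zero_le _)
        have hne (s : Fin k) : i s.succ ≠ 0 := by
          rw [← hi0]; exact (hi (Fin.succ_pos s)).ne'
        obtain ⟨j, rfl⟩ : ∃ j : Fin k → Fin N,
            i = Fin.cons (α := fun _ => Fin (N + 1)) 0 (Fin.succ ∘ j) := by
          refine ⟨fun s => (i s.succ).pred (hne s), funext fun s => ?_⟩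
          refine Fin.cases ?_ (fun s => ?_) s
          · simpa using hi0
          · simp
        have hj : StrictMono j := fun s s' hs => by
          simpa using hi (Fin.succ_lt_succ_iff.2 hs)
        rw [lintegral_fin_cons (f := fun y : Fin (k + 1) → ℝ => chainWeight a
            (Fin.cons (α := fun _ => Fin (N + 1)) 0 (Fin.succ ∘ j)) y * g y)
          (((measurable_chainWeight _).comp (measurable_prodMk_left (x := a))).mul hg)]
        refine lintegral_congr fun b => ?_
        simp only [chainWeight_cons]
        by_cases hab : a ≤ b
        swap
        · simp [hab]
        simp only [hab, true_and, if_true]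
        rw [← ih j hj b (g := fun y => g (Fin.cons (α := fun _ => ℝ) b y))
          (hg.comp (measurable_fin_cons.comp (measurable_prodMk_left (x := b))))]
        refine lintegral_congr fun x => ?_
        congr 2
        funext s
        refine Fin.cases ?_ (fun s => ?_) s <;> simp
    · push Not at h0
      obtain ⟨j, rfl⟩ : ∃ j : Fin k → Fin N, i = Fin.succ ∘ j :=
        ⟨fun s => (i s).pred (h0 s), funext fun s => by simp⟩
      have hj : StrictMono j := fun s s' hs => by simpa using hi hs
      have hm : Measurable fun p : ℝ × (Fin k → ℝ) =>
          (if a ≤ p.1 then chainWeight p.1 j p.2 else 0) * g p.2 :=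
        (Measurable.ite (measurableSet_le measurable_const measurable_fst)
          (measurable_chainWeight j) measurable_const).mul (hg.comp measurable_snd)
      have step (b : ℝ) : (∫⁻ x : Fin N → ℝ, if a ≤ b ∧ Monotone (withEnds b x) then
            g ((Fin.cons (α := fun _ => ℝ) b x : Fin (N + 1) → ℝ) ∘ (Fin.succ ∘ j)) else 0)
          = ∫⁻ y, (if a ≤ b then chainWeight b j y else 0) * g y := by
        by_cases hab : a ≤ b
        swap
        · simp [hab]
        simp only [hab, true_and, if_true]
        rw [← ih j hj b hg]
        rfl
      simp only [step]
      -- Since `g` does not see `b`, Tonelli moves the `b`-integral onto the weight alone.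
      rw [lintegral_lintegral_swap hm.aemeasurable]
      refine lintegral_congr fun y => ?_
      rw [← lintegral_chainWeight, lintegral_mul_const]
      exact Measurable.ite (measurableSet_le measurable_const measurable_id)
        ((measurable_chainWeight j).comp (measurable_prodMk_right (y := y))) measurable_const

end OrderStat

/-! ### Order statistics and reduction to the increasing chamber -/

namespace OrderStat

/-- Ties may change the sorting permutation but not the sorted values. -/
lemma orderStat_eq_of_monotone {N : ℕ} {v : Fin N → ℝ} {σ : Equiv.Perm (Fin N)}
    (h : Monotone (v ∘ σ)) (r : Fin N) : orderStat v r = v (σ r) :=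
  (congrFun (Tuple.comp_sort_eq_comp_iff_monotone.2 h) r).symm

lemma orderStat_comp_perm {N : ℕ} (v : Fin N → ℝ) (σ : Equiv.Perm (Fin N)) :
    orderStat (v ∘ σ) = orderStat v := by
  funext r
  have h : Monotone (v ∘ (((Tuple.sort (v ∘ σ)).trans σ : Equiv.Perm (Fin N)))) :=
    Tuple.monotone_sort (v ∘ σ)
  rw [orderStat_eq_of_monotone h]
  rfl

lemma measurable_orderStat {N : ℕ} (r : Fin N) :
    Measurable fun v : Fin N → ℝ => orderStat v r := by
  refine measurable_of_Iic fun a => ?_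
  have : (fun v : Fin N → ℝ => orderStat v r) ⁻¹' Set.Iic a
      = ⋃ σ : Equiv.Perm (Fin N), {v | Monotone (v ∘ σ)} ∩ {v | v (σ r) ≤ a} := by
    ext v
    simp only [Set.mem_preimage, Set.mem_Iic, Set.mem_iUnion, Set.mem_inter_iff, Set.mem_ofPred_eq]
    constructor
    · exact fun h => ⟨Tuple.sort v, Tuple.monotone_sort v, h⟩
    · rintro ⟨σ, h, h'⟩
      rwa [orderStat_eq_of_monotone h]
  rw [this]
  refine MeasurableSet.iUnion fun σ => MeasurableSet.inter ?_
    (measurableSet_le (measurable_pi_apply _) measurable_const)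
  simp only [Monotone, Set.ofPred_forall]
  exact MeasurableSet.iInter fun s => MeasurableSet.iInter fun s' => MeasurableSet.iInter fun _ =>
    measurableSet_le (measurable_pi_apply _) (measurable_pi_apply _)

lemma measurableSet_monotone {N : ℕ} : MeasurableSet {x : Fin N → ℝ | Monotone x} := by
  simp only [Monotone, Set.ofPred_forall]
  exact MeasurableSet.iInter fun s => MeasurableSet.iInter fun s' => MeasurableSet.iInter fun _ =>
    measurableSet_le (measurable_pi_apply _) (measurable_pi_apply _)

/-- Coincidences lie in finitely many proper subspaces. -/
lemma ae_injective (N : ℕ) : ∀ᵐ x : Fin N → ℝ, Function.Injective x := by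
  have h : ∀ a b : Fin N, a ≠ b → ∀ᵐ x : Fin N → ℝ, x a ≠ x b := by
    intro a b hab
    have h0 := Measure.addHaar_submodule (volume : Measure (Fin N → ℝ))
      (LinearMap.ker ((LinearMap.proj a : (Fin N → ℝ) →ₗ[ℝ] ℝ) - LinearMap.proj b)) (by
        intro htop
        have : (Pi.single a 1 : Fin N → ℝ) ∈
          LinearMap.ker ((LinearMap.proj a : (Fin N → ℝ) →ₗ[ℝ] ℝ) - LinearMap.proj b) := by
          rw [htop]; trivial
        simp [hab.symm] at this)
    rw [ae_iff]
    convert h0 using 2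
    ext x
    simp [sub_eq_zero]
  have h' : ∀ᵐ x : Fin N → ℝ, ∀ a b : Fin N, a ≠ b → x a ≠ x b := by
    simp only [ae_all_iff]
    exact h
  filter_upwards [h'] with x hx a b hab
  by_contra hne
  exact hx a b hne hab

lemma ae_apply_ne {N : ℕ} (j : Fin N) (c : ℝ) : ∀ᵐ x : Fin N → ℝ, x j ≠ c := by
  rw [ae_iff]
  simpa [volume_pi] using Measure.pi_hyperplane (fun _ : Fin N => (volume : Measure ℝ)) j c

open Classical in
/-- A permutation invariant function integrates to `N!` times its integral over the increasing
chamber. -/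
theorem lintegral_eq_factorial_mul_monotone {N : ℕ} {f : (Fin N → ℝ) → ENNReal}
    (hf : Measurable f) (hperm : ∀ x (σ : Equiv.Perm (Fin N)), f (x ∘ σ) = f x) :
    ∫⁻ x, f x = N.factorial * ∫⁻ x, if Monotone x then f x else 0 := by
  have hm : Measurable fun x : Fin N → ℝ => if Monotone x then f x else 0 :=
    Measurable.ite measurableSet_monotone hf measurable_const
  have hpres (σ : Equiv.Perm (Fin N)) :
      MeasurePreserving (fun x : Fin N → ℝ => x ∘ σ) volume volume := by
    have := (volume_measurePreserving_piCongrLeft (fun _ : Fin N => ℝ) σ).symm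
    exact this
  -- Without ties exactly one permutation sorts `x`, so a single term survives.
  have hsum : ∀ᵐ x : Fin N → ℝ, f x
      = ∑ σ : Equiv.Perm (Fin N), if Monotone (x ∘ σ) then f (x ∘ σ) else 0 := by
    filter_upwards [ae_injective N] with x hx
    have hiff (σ : Equiv.Perm (Fin N)) : Monotone (x ∘ σ) ↔ σ = Tuple.sort x := by
      rw [← Tuple.comp_sort_eq_comp_iff_monotone]
      refine ⟨fun h => Equiv.ext fun r => hx (congrFun h r), fun h => by rw [h]⟩
    simp only [hiff, hperm]
    simp
  rw [lintegral_congr_ae hsum, lintegral_finsetSum]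
  · rw [Finset.sum_congr rfl fun σ _ => (hpres σ).lintegral_comp hm]
    simp [Fintype.card_perm]
  · exact fun σ _ => hm.comp (hpres σ).measurable

end OrderStat

/-! ### Quantile transform -/

namespace OrderStat

open Classical in
/-- The quantile function of `ν` on `(0, 1)`, extended by `0`. -/
noncomputable def quantile (ν : Measure ℝ) (p : ℝ) : ℝ :=
  if p ∈ Set.Ioo (0 : ℝ) 1 then sInf {x | p ≤ cdf ν x} else 0

variable {ν : Measure ℝ}

lemma quantile_le_iff {p : ℝ} (hp : p ∈ Set.Ioo (0 : ℝ) 1) (x : ℝ) :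
    quantile ν p ≤ x ↔ p ≤ cdf ν x := by
  have hne : {x | p ≤ cdf ν x}.Nonempty :=
    (((tendsto_cdf_atTop ν).eventually_const_lt hp.2).mono fun _ h => le_of_lt h).exists
  have hbdd : BddBelow {x | p ≤ cdf ν x} := by
    obtain ⟨y, hy⟩ := ((tendsto_cdf_atBot ν).eventually_lt_const hp.1).exists
    refine ⟨y, fun x hx => ?_⟩
    by_contra! h
    exact absurd (hx.trans (monotone_cdf ν h.le)) (not_le.2 hy)
  unfold quantile
  rw [if_pos hp]
  refine ⟨fun h => ?_, fun h => csInf_le hbdd h⟩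
  refine le_trans ?_ (monotone_cdf ν h)
  -- Right continuity of the distribution function makes the infimum attained.
  have ht := ((cdf ν).right_continuous (sInf {x | p ≤ cdf ν x})).mono Set.Ioi_subset_Ici_self
  refine ge_of_tendsto ht (eventually_nhdsWithin_of_forall fun y hy => ?_)
  obtain ⟨z, hz, hzy⟩ := exists_lt_of_csInf_lt hne hy
  exact le_trans hz (monotone_cdf ν hzy.le)

lemma quantile_monotoneOn : MonotoneOn (quantile ν) (Set.Ioo (0 : ℝ) 1) := fun _ hp _ hp' h =>
  (quantile_le_iff hp _).2 (h.trans ((quantile_le_iff hp' _).1 le_rfl))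

lemma measurable_quantile : Measurable (quantile ν) := by
  refine measurable_of_Iic fun x => ?_
  have : quantile ν ⁻¹' Set.Iic x
      = (Set.Ioo (0 : ℝ) 1 ∩ Set.Iic (cdf ν x)) ∪ ((Set.Ioo (0 : ℝ) 1)ᶜ ∩ {_p | 0 ≤ x}) := by
    ext p
    by_cases hp : p ∈ Set.Ioo (0 : ℝ) 1
    · simp only [Set.mem_preimage, Set.mem_Iic, quantile_le_iff hp, Set.mem_union,
        Set.mem_inter_iff, hp, Set.mem_compl_iff, true_and, not_true_eq_false, false_and, or_false]
    · simp [hp, quantile, -Set.mem_Ioo]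
  rw [this]
  exact (measurableSet_Ioo.inter measurableSet_Iic).union
    (measurableSet_Ioo.compl.inter (MeasurableSet.const _))

theorem map_quantile [IsProbabilityMeasure ν] :
    (volume.restrict (Set.Ioo (0 : ℝ) 1)).map (quantile ν) = ν := by
  have : IsProbabilityMeasure (volume.restrict (Set.Ioo (0 : ℝ) 1)) := ⟨by simp⟩
  have := Measure.isProbabilityMeasure_map (μ := volume.restrict (Set.Ioo (0 : ℝ) 1))
    (measurable_quantile (ν := ν)).aemeasurable
  refine Measure.ext_of_Iic _ _ fun x => ?_
  rw [Measure.map_apply measurable_quantile measurableSet_Iic,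
    Measure.restrict_apply (measurable_quantile measurableSet_Iic), ← ofReal_cdf ν x]
  have h0 := cdf_nonneg ν x
  have h1 := cdf_le_one ν x
  have h : quantile ν ⁻¹' Set.Iic x ∩ Set.Ioo 0 1 = Set.Iic (cdf ν x) ∩ Set.Ioo 0 1 := by
    ext p
    exact and_congr_left fun hp => quantile_le_iff hp x
  rw [h]
  have h' : (Set.Iic (cdf ν x) ∩ Set.Ioo (0 : ℝ) 1 : Set ℝ) =ᵐ[volume]
      (Set.Ioo 0 (cdf ν x) : Set ℝ) := by
    have hae : ∀ᵐ p : ℝ, p ≠ cdf ν x := by simp [ae_iff]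
    filter_upwards [hae] with p hp
    refine propext ⟨fun hpx => ⟨hpx.2.1, lt_of_le_of_ne hpx.1 hp⟩, fun hpx => ?_⟩
    exact ⟨hpx.2.le, hpx.1, hpx.2.trans_le h1⟩
  rw [measure_congr h', Real.volume_Ioo, sub_zero]

lemma bddAbove_image_cdf (s : Set ℝ) : BddAbove ((fun x => cdf ν x) '' s) :=
  ⟨1, by rintro _ ⟨x, _, rfl⟩; exact cdf_le_one ν x⟩

lemma supBelow_cdf_le {a : ℝ} (ha : 0 ≤ a) : supBelow (fun x => cdf ν x) a ≤ a :=
  Real.sSup_le (by rintro _ ⟨x, hx, rfl⟩; exact le_of_lt hx) ha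

/-- At `p` equal to the supremum the answer depends on whether it is attained; that single point is
negligible later. -/
lemma cdf_quantile_lt_iff {p a : ℝ} (hp : p ∈ Set.Ioo (0 : ℝ) 1)
    (hne : p ≠ supBelow (fun x => cdf ν x) a) :
    cdf ν (quantile ν p) < a ↔ p ≤ supBelow (fun x => cdf ν x) a := by
  constructor
  · intro h
    exact ((quantile_le_iff hp _).1 le_rfl).trans
      (le_csSup (bddAbove_image_cdf _) ⟨quantile ν p, h, rfl⟩)
  · intro h
    have hlt := lt_of_le_of_ne h hne
    -- If no value is below `a`, the supremum is `0` by convention, contradicting `0 < p`.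
    have hS : ((fun x => cdf ν x) '' {x | cdf ν x < a}).Nonempty := by
      by_contra hemp
      rw [Set.not_nonempty_iff_eq_empty] at hemp
      rw [supBelow, hemp, Real.sSup_empty] at hlt
      exact absurd hp.1 (not_lt.2 hlt.le)
    obtain ⟨_, ⟨x, hx, rfl⟩, hpx⟩ := exists_lt_of_lt_csSup hS hlt
    exact (monotone_cdf ν ((quantile_le_iff hp x).2 hpx.le)).trans_lt hx

lemma supBelow_cdf_eq {a : ℝ} (ha : 0 ≤ a) (ha1 : a ≤ 1)
    (hc : Continuous fun x => cdf ν x) : supBelow (fun x => cdf ν x) a = a := by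
  refine le_antisymm (supBelow_cdf_le ha) (le_of_forall_lt fun c hca => ?_)
  rcases lt_or_ge c 0 with hc0 | hc0
  · exact hc0.trans_le (Real.sSup_nonneg (by rintro _ ⟨x, _, rfl⟩; exact cdf_nonneg ν x))
  -- Here `0 < d < 1`, so the limits at both ends let continuity attain `d`.
  obtain ⟨d, hcd, hda⟩ := exists_between hca
  obtain ⟨y, hy⟩ := ((tendsto_cdf_atBot ν).eventually_lt_const (hc0.trans_lt hcd)).exists
  obtain ⟨z, hz⟩ := ((tendsto_cdf_atTop ν).eventually_const_lt (hda.trans_le ha1)).exists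
  obtain ⟨x, hx⟩ := mem_range_of_exists_le_of_exists_ge hc ⟨y, hy.le⟩ ⟨z, hz.le⟩
  exact hcd.trans_le (le_csSup (bddAbove_image_cdf _)
    ⟨x, by simpa [hx] using hda, hx⟩)

end OrderStat

/-! ### Joint law of the selected order statistics -/

namespace OrderStat

lemma monotone_withEnds_zero_iff {k : ℕ} (x : Fin k → ℝ) :
    Monotone (withEnds 0 x) ↔ (∀ s, 0 ≤ x s) ∧ Monotone x ∧ ∀ s, x s ≤ 1 := by
  have hx (s : Fin k) : withEnds 0 x s.castSucc.succ = x s := by simp [withEnds]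
  have hl : withEnds 0 x (Fin.last k).succ = 1 := by simp [withEnds]
  have h0 : withEnds 0 x 0 = 0 := rfl
  constructor
  · intro h
    refine ⟨fun s => ?_, fun s s' hs => ?_, fun s => ?_⟩
    · rw [← hx s, ← h0]; exact h (Fin.zero_le _)
    · rw [← hx s, ← hx s']; exact h (by simpa using hs)
    · rw [← hx s, ← hl]; exact h (Fin.succ_le_succ_iff.2 (Fin.le_last _))
  · rintro ⟨hnn, hm, h1⟩ p q hpq
    induction p using Fin.cases with
    | zero =>
      rw [h0]
      induction q using Fin.cases with
      | zero => rw [h0]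
      | succ q =>
        induction q using Fin.lastCases with
        | last => rw [hl]; exact zero_le_one
        | cast q => rw [hx]; exact hnn q
    | succ p =>
      induction q using Fin.cases with
      | zero => exact absurd hpq (by simp)
      | succ q =>
        induction p using Fin.lastCases with
        | last =>
          have : q = Fin.last k := Fin.last_le_iff.1 (Fin.succ_le_succ_iff.1 hpq)
          rw [this]
        | cast p =>
          induction q using Fin.lastCases with
          | last => rw [hl, hx]; exact h1 p
          | cast q => rw [hx, hx]; exact hm (by simpa using hpq)

lemma density_eq {k N : ℕ} (i : Fin k → Fin N) (x : Fin k → ℝ) :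
    density i x = N.factorial * gapWeight 0 i x := rfl

lemma continuous_density {k N : ℕ} (i : Fin k → Fin N) : Continuous (density i) :=
  continuous_const.mul ((continuous_gapWeight i).comp (Continuous.prodMk_right (0 : ℝ)))

lemma monotone_withEnds_of_mem_region {k : ℕ} {t : Fin k → ℝ} (ht : ∀ s, t s ≤ 1) {x : Fin k → ℝ}
    (hx : x ∈ region t) : Monotone (withEnds 0 x) :=
  (monotone_withEnds_zero_iff x).2 ⟨hx.1, hx.2.1, fun s => (hx.2.2 s).trans (ht s)⟩

lemma density_nonneg_of_mem_region {k N : ℕ} (i : Fin k → Fin N) {t : Fin k → ℝ}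
    (ht : ∀ s, t s ≤ 1) {x : Fin k → ℝ} (hx : x ∈ region t) : 0 ≤ density i x :=
  mul_nonneg (Nat.cast_nonneg _) (gapWeight_nonneg i (monotone_withEnds_of_mem_region ht hx))

lemma region_subset_Icc {k : ℕ} (t : Fin k → ℝ) : region t ⊆ Set.Icc 0 t :=
  fun _ hx => ⟨hx.1, hx.2.2⟩

lemma measurableSet_forall_le {k : ℕ} (t : Fin k → ℝ) :
    MeasurableSet {x : Fin k → ℝ | ∀ s, x s ≤ t s} := by
  simp only [Set.ofPred_forall]
  exact MeasurableSet.iInter fun s => measurableSet_le (measurable_pi_apply s) measurable_const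

lemma measurableSet_region {k : ℕ} (t : Fin k → ℝ) : MeasurableSet (region t) := by
  have h : MeasurableSet {x : Fin k → ℝ | ∀ s, 0 ≤ x s} := by
    simp only [Set.ofPred_forall]
    exact MeasurableSet.iInter fun s => measurableSet_le measurable_const (measurable_pi_apply s)
  exact h.inter (measurableSet_monotone.inter (measurableSet_forall_le t))

lemma integrableOn_density {k N : ℕ} (i : Fin k → Fin N) (t : Fin k → ℝ) :
    IntegrableOn (density i) (region t) :=
  ((continuous_density i).continuousOn.integrableOn_compact isCompact_Icc).mono_set
    (region_subset_Icc t)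

lemma pi_eq_map_quantile (ν : Measure ℝ) [IsProbabilityMeasure ν] (N : ℕ) :
    Measure.pi (fun _ : Fin N => ν)
      = (volume.restrict (Set.univ.pi fun _ : Fin N => Set.Ioo (0 : ℝ) 1)).map
          fun x j => quantile ν (x j) := by
  rw [volume_pi, Measure.restrict_pi_pi]
  have : ∀ j : Fin N, SigmaFinite ((volume.restrict (Set.Ioo (0 : ℝ) 1)).map (quantile ν)) := by
    intro j; rw [map_quantile]; infer_instance
  rw [Measure.pi_map_pi (f := fun _ : Fin N => quantile ν)
    fun _ => measurable_quantile.aemeasurable]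
  simp only [map_quantile]

lemma measurableSet_cdf_orderStat_lt (ν : Measure ℝ) {k N : ℕ} (i : Fin k → Fin N)
    (t : Fin k → ℝ) :
    MeasurableSet {v : Fin N → ℝ | ∀ s, cdf ν (orderStat v (i s)) < t s} := by
  simp only [Set.ofPred_forall]
  exact MeasurableSet.iInter fun s => measurableSet_lt
    ((monotone_cdf ν).measurable.comp (measurable_orderStat (i s))) measurable_const

/-- Joint distribution of the transformed order statistics of an i.i.d. sample. -/
theorem pi_cdf_orderStat_lt (ν : Measure ℝ) [IsProbabilityMeasure ν] {k N : ℕ}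
    (i : Fin k → Fin N) (hi : StrictMono i) (t : Fin k → ℝ) (ht0 : ∀ s, 0 ≤ t s)
    (ht1 : ∀ s, t s ≤ 1) :
    Measure.pi (fun _ : Fin N => ν) {v | ∀ s, cdf ν (orderStat v (i s)) < t s}
      = ∫⁻ x in region fun s => supBelow (fun γ => cdf ν γ) (t s),
          ENNReal.ofReal (density i x) := by
  classical
  set τ : Fin k → ℝ := fun s => supBelow (fun γ => cdf ν γ) (t s) with hτ
  -- `region` has no bound by `1` of its own; this supplies the last link of the chain.
  have hτ1 (s : Fin k) : τ s ≤ 1 := (supBelow_cdf_le (ht0 s)).trans (ht1 s)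
  set Q : (Fin N → ℝ) → Fin N → ℝ := fun x j => quantile ν (x j) with hQ
  have hQm : Measurable Q :=
    measurable_pi_lambda _ fun j => measurable_quantile.comp (measurable_pi_apply j)
  have hE := measurableSet_cdf_orderStat_lt ν i t
  set A : Set (Fin N → ℝ) := Q ⁻¹' {v | ∀ s, cdf ν (orderStat v (i s)) < t s}
    ∩ Set.univ.pi fun _ => Set.Ioo (0 : ℝ) 1 with hA
  have hAm : MeasurableSet A :=
    (hQm hE).inter (MeasurableSet.univ_pi fun _ => measurableSet_Ioo)
  have hAperm (x : Fin N → ℝ) (σ : Equiv.Perm (Fin N)) : x ∘ σ ∈ A ↔ x ∈ A := by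
    have h1 : Q (x ∘ σ) = Q x ∘ σ := rfl
    have h2 : (∀ j, (x ∘ σ) j ∈ Set.Ioo (0 : ℝ) 1) ↔ ∀ j, x j ∈ Set.Ioo (0 : ℝ) 1 :=
      σ.forall_congr_left.trans (by simp)
    rw [hA, Set.mem_inter_iff, Set.mem_inter_iff, Set.mem_univ_pi, Set.mem_univ_pi, h2,
      Set.mem_preimage, Set.mem_preimage, h1, Set.mem_ofPred_eq, Set.mem_ofPred_eq,
      orderStat_comp_perm]
  -- The discarded null sets are the faces separating the open cube from the closed one and the
  -- exceptional points `x (i s) = τ s`.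
  have hAmono : ∀ᵐ x : Fin N → ℝ, Monotone x →
      (x ∈ A ↔ Monotone (withEnds 0 x) ∧ ∀ s, (x ∘ i) s ≤ τ s) := by
    have hne0 : ∀ᵐ x : Fin N → ℝ, ∀ j, x j ≠ 0 := ae_all_iff.2 fun j => ae_apply_ne j 0
    have hne1 : ∀ᵐ x : Fin N → ℝ, ∀ j, x j ≠ 1 := ae_all_iff.2 fun j => ae_apply_ne j 1
    have hneτ : ∀ᵐ x : Fin N → ℝ, ∀ s, x (i s) ≠ τ s :=
      ae_all_iff.2 fun s => ae_apply_ne (i s) (τ s)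
    filter_upwards [hne0, hne1, hneτ] with x h0 h1 h2 hx
    have hcube : (∀ j, x j ∈ Set.Ioo (0 : ℝ) 1) ↔ Monotone (withEnds 0 x) := by
      rw [monotone_withEnds_zero_iff]
      exact ⟨fun h => ⟨fun j => (h j).1.le, hx, fun j => (h j).2.le⟩,
        fun h j => ⟨lt_of_le_of_ne (h.1 j) (h0 j).symm, lt_of_le_of_ne (h.2.2 j) (h1 j)⟩⟩
    rw [hA, Set.mem_inter_iff, Set.mem_univ_pi, ← hcube, and_comm]
    refine and_congr_right fun hI => forall_congr' fun s => ?_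
    have hQx : Monotone (Q x ∘ (1 : Equiv.Perm (Fin N))) := fun a b hab =>
      quantile_monotoneOn (hI a) (hI b) (hx hab)
    rw [orderStat_eq_of_monotone hQx]
    exact cdf_quantile_lt_iff (hI (i s)) (h2 s)
  have hgm : Measurable fun y : Fin k → ℝ => if ∀ s, y s ≤ τ s then (1 : ENNReal) else 0 :=
    Measurable.ite (measurableSet_forall_le τ) measurable_const measurable_const
  have hfm : Measurable fun x : Fin N → ℝ => if x ∈ A then (1 : ENNReal) else 0 :=
    Measurable.ite hAm measurable_const measurable_const
  calc Measure.pi (fun _ : Fin N => ν) {v | ∀ s, cdf ν (orderStat v (i s)) < t s}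
      = volume A := by
        rw [pi_eq_map_quantile, Measure.map_apply hQm hE, Measure.restrict_apply (hQm hE)]
    _ = ∫⁻ x, if x ∈ A then (1 : ENNReal) else 0 := by
        rw [← lintegral_indicator_one hAm]
        exact lintegral_congr fun x => by simp [Set.indicator_apply]
    _ = N.factorial * ∫⁻ x, if Monotone x then (if x ∈ A then (1 : ENNReal) else 0) else 0 :=
        lintegral_eq_factorial_mul_monotone hfm fun x σ => by simp only [hAperm]
    _ = N.factorial * ∫⁻ x : Fin N → ℝ, if Monotone (withEnds 0 x) then
          (if ∀ s, (x ∘ i) s ≤ τ s then (1 : ENNReal) else 0) else 0 := by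
        congr 1
        refine lintegral_congr_ae ?_
        filter_upwards [hAmono] with x hx
        by_cases hm : Monotone x
        · simp only [hm, if_true, hx hm, ite_and]
        · have : ¬ Monotone (withEnds 0 x) := fun h =>
            hm ((monotone_withEnds_zero_iff x).1 h).2.1
          simp only [hm, this, if_false]
    _ = N.factorial * ∫⁻ y, chainWeight 0 i y * if ∀ s, y s ≤ τ s then (1 : ENNReal) else 0 := by
        rw [lintegral_monotone_comp i hi 0 hgm]
    _ = ∫⁻ x in region τ, ENNReal.ofReal (density i x) := by
        rw [← lintegral_const_mul' _ _ (ENNReal.natCast_ne_top _),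
          ← lintegral_indicator (measurableSet_region τ)]
        refine lintegral_congr fun y => ?_
        have hiff : y ∈ region τ ↔ Monotone (withEnds 0 y) ∧ ∀ s, y s ≤ τ s :=
          ⟨fun h => ⟨monotone_withEnds_of_mem_region hτ1 h, h.2.2⟩, fun h =>
            ⟨((monotone_withEnds_zero_iff y).1 h.1).1, ((monotone_withEnds_zero_iff y).1 h.1).2.1,
              h.2⟩⟩
        rw [Set.indicator_apply, density_eq, ENNReal.ofReal_mul (Nat.cast_nonneg _),
          ENNReal.ofReal_natCast]
        unfold chainWeight
        by_cases h1 : Monotone (withEnds 0 y) <;> by_cases h2 : ∀ s, y s ≤ τ s <;>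
          simp [hiff, h1, h2]

lemma map_sample_eq_pi {𝓠 Ω : Type*} [MeasurableSpace 𝓠] [MeasurableSpace Ω]
    {μ : Measure 𝓠} {P : Measure Ω} [IsProbabilityMeasure P] {u : 𝓠 → ℝ} (hu : Measurable u)
    {N : ℕ} {q : Fin N → Ω → 𝓠} (hlaw : ∀ j, HasLaw (q j) μ P) (hindep : iIndepFun q P) :
    P.map (fun ω j => u (q j ω)) = Measure.pi fun _ : Fin N => μ.map u := by
  have h := (iIndepFun_iff_map_fun_eq_pi_map
    (fun j => hu.comp_aemeasurable (hlaw j).aemeasurable)).1 (hindep.comp (fun _ => u) fun _ => hu)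
  refine h.trans ?_
  congr 1
  funext j
  rw [← (hlaw j).map_eq, AEMeasurable.map_map_of_aemeasurable hu.aemeasurable (hlaw j).aemeasurable]

end OrderStat

theorem theorem2
    {𝓠 Ω : Type*} [MeasurableSpace 𝓠] [MeasurableSpace Ω]
    -- law of the random vector, and the probability space carrying the samples
    (μ : Measure 𝓠) [IsProbabilityMeasure μ] (P : Measure Ω) [IsProbabilityMeasure P]
    (u : 𝓠 → ℝ) (hu : Measurable u)
    -- i.i.d. samples
    (N : ℕ) (q : Fin N → Ω → 𝓠) (hlaw : ∀ j, HasLaw (q j) μ P) (hindep : iIndepFun q P)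
    -- selected ranks (counted from 0) and thresholds
    (k : ℕ) (hk : 1 ≤ k) (i : Fin k → Fin N) (hi : StrictMono i)
    (t : Fin k → ℝ) (ht : Monotone t) (ht0 : ∀ s, 0 ≤ t s) (ht1 : ∀ s, t s ≤ 1) :
    let F : ℝ → ℝ := fun γ => cdf (μ.map u) γ
    let τ : Fin k → ℝ := fun s => OrderStat.supBelow F (t s)
    let Ftilde : ℝ :=
      P.real {ω | ∀ s, F (OrderStat.orderStat (fun j => u (q j ω)) (i s)) < t s}
    Ftilde = ∫ x in OrderStat.region τ, OrderStat.density i x ∧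
    Ftilde ≤ ∫ x in OrderStat.region t, OrderStat.density i x ∧
    (Continuous F → Ftilde = ∫ x in OrderStat.region t, OrderStat.density i x) := by
  intro F τ Ftilde
  have : IsProbabilityMeasure (μ.map u) := Measure.isProbabilityMeasure_map hu.aemeasurable
  have hτt (s : Fin k) : τ s ≤ t s := OrderStat.supBelow_cdf_le (ht0 s)
  have hmain : Ftilde = ∫ x in OrderStat.region τ, OrderStat.density i x := by
    have hm : AEMeasurable (fun ω j => u (q j ω)) P :=
      aemeasurable_pi_lambda _ fun j => hu.comp_aemeasurable (hlaw j).aemeasurable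
    rw [integral_eq_lintegral_of_nonneg_ae
      ((ae_restrict_iff' (OrderStat.measurableSet_region τ)).2 (ae_of_all _ fun x hx =>
        OrderStat.density_nonneg_of_mem_region i (fun s => (hτt s).trans (ht1 s)) hx))
      (OrderStat.continuous_density i).aestronglyMeasurable,
      ← OrderStat.pi_cdf_orderStat_lt (μ.map u) i hi t ht0 ht1,
      ← OrderStat.map_sample_eq_pi hu hlaw hindep,
      Measure.map_apply_of_aemeasurable hm
        (OrderStat.measurableSet_cdf_orderStat_lt (μ.map u) i t)]
    rfl
  refine ⟨hmain, ?_, fun hc => ?_⟩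
  · rw [hmain]
    refine setIntegral_mono_set (OrderStat.integrableOn_density i t)
      ((ae_restrict_iff' (OrderStat.measurableSet_region t)).2 (ae_of_all _ fun x hx =>
        OrderStat.density_nonneg_of_mem_region i ht1 hx)) (Filter.Eventually.of_forall ?_)
    exact fun x hx => ⟨hx.1, hx.2.1, fun s => (hx.2.2 s).trans (hτt s)⟩
  · rw [hmain, show τ = t from funext fun s => OrderStat.supBelow_cdf_eq (ht0 s) (ht1 s) hc]
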